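/- Let $d\in\{2,3\}$, $R>0$, $\kappa>0$, and let $S_R\subset\mathbb R^d$ be the sphere of radius $R$ centred at the origin. For $d=2$ let $Y_n(\varphi)=e^{in\varphi}/\sqrt{2\pi}$ ($n\in\mathbb Z$) be the circular harmonics, $H_n^{(1)}$ the cylindrical Hankel functions of the first kind and $Z_n(\xi)=\xi H_n^{(1)\prime}(\xi)/H_n^{(1)}(\xi)$; for $d=3$ let $Y_n^m$ ($n\in\mathbb N_0$, $|m|\le n$) be the $L^2(S_1)$-orthonormal spherical harmonics, $h_n^{(1)}(x)=\sqrt{\pi/(2x)}\,H^{(1)}_{n+1/2}(x)$ the spherical Hankel functions of the first kind and $z_n(\xi)=\xi h_n^{(1)\prime}(\xi)/h_n^{(1)}(\xi)$. For $v\in L^2(S_R)$ denote by $v_n(R)=\int_{S_1}v(R\hat x)\overline{Y_n(\hat x)}\,ds(\hat x)$, resp. $v_n^m(R)=\int_{S_1}v(R\hat x)\overline{Y_n^m(\hat x)}\,ds(\hat x)$, its Fourier coefficients; $H^{1/2}(S_R)$ consists of those $v\in L^2(S_R)$ for which $$\|v\|_{1/2,2,S_R}^2=R\sum_{n\in\mathbb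 Z}(1+n^2)^{1/2}|v_n(R)|^2,\quad\text{resp.}\quad \|v\|_{1/2,2,S_R}^2=R^2\sum_{n\ge0}\sum_{|m|\le n}(1+n^2)^{1/2}|v_n^m(R)|^2,$$ is finite. Let $H^{-1/2}(S_R)$ be the space of bounded antilinear functionals on $H^{1/2}(S_R)$, and let $(\cdot,\cdot)_{S_R}$ be the pairing of $H^{-1/2}(S_R)$ with $H^{1/2}(S_R)$ that extends $(g,v)_{S_R}=\int_{S_R}g\,\overline v\,ds$. The Dirichlet-to-Neumann operator is, for $w\in H^{1/2}(S_R)$ and $x=R\hat x\in S_R$, $$T_\kappa w(x)=\frac1R\sum_{n\in\mathbb Z}Z_n(\kappa R)\,w_n(R)\,Y_n(\hat x),\quad\text{resp.}\quad T_\kappa w(x)=\frac1R\sum_{n\ge0}\sum_{|m|\le n}z_n(\kappa R)\,w_n^m(R)\,Y_n^m(\hat x),$$ and for $N\in\mathbb N_0$ the truncated operator $T_{\kappa,N}$ is given by the same sums restricted to $|n|\le N$, resp. $n\le N$. Then, for every $w\in H^{1/2}(S_R)$, the series of $T_\kappa w$ converges (unconditionally) in $H^{-1/2}(S_R)$, and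 there are numbers $c(N,w,v)\ge0$ ($N\in\mathbb N_0$, $w,v\in H^{1/2}(S_R)$) with $\lim_{N\to\infty}c(N,w,v)=0$ for all $w,v\in H^{1/2}(S_R)$ such that $$\left|\left((T_\kappa-T_{\kappa,N})w,v\right)_{S_R}\right|\le c(N,w,v)\,\|w\|_{1/2,2,S_R}\,\|v\|_{1/2,2,S_R}$$ for all $w,v\in H^{1/2}(S_R)$ and $N\in\mathbb N_0$. -/

import Mathlib

open MeasureTheory Filter Topology Metric
open scoped Nat ENNReal

noncomputable section

namespace DtN

/-! ### Bessel and Hankel functions of a positive argument -/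

/-- Bessel function of the first kind `J_ν`, for real order (`1 / Γ` vanishes at the poles of `Γ`,
which agrees with Lean's conventions). -/
def besselJ (ν x : ℝ) : ℝ :=
  ∑' k : ℕ, (-1) ^ k / ((k ! : ℝ) * Real.Gamma (ν + k + 1)) * (x / 2) ^ (2 * (k : ℝ) + ν)

/-- Bessel function of the second kind `Y_ν` for a non-integer order `ν`. -/
def besselY (ν x : ℝ) : ℝ :=
  (besselJ ν x * Real.cos (ν * Real.pi) - besselJ (-ν) x) / Real.sin (ν * Real.pi)

/-- `ψ (m + 1)`, the digamma function at a positive integer. -/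
def digammaSucc (m : ℕ) : ℝ := (harmonic m : ℝ) - Real.eulerMascheroniConstant

/-- Bessel function of the second kind `Y_n` (Neumann function) of integer order `n ≥ 0`. -/
def neumannY (n : ℕ) (x : ℝ) : ℝ :=
  2 / Real.pi * Real.log (x / 2) * besselJ n x
    - 1 / Real.pi * ∑ k ∈ Finset.range n,
        ((n - 1 - k)! : ℝ) / (k ! : ℝ) * (x / 2) ^ (2 * (k : ℤ) - (n : ℤ))
    - 1 / Real.pi * ∑' k : ℕ,
        (-1) ^ k * (digammaSucc k + digammaSucc (n + k)) / ((k ! : ℝ) * ((n + k)! : ℝ))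
          * (x / 2) ^ (2 * k + n)

/-- Cylindrical Hankel function of the first kind `H_n^{(1)} = J_n + i Y_n` of integer order,
with `H_{-n}^{(1)} = (-1)^n H_n^{(1)}`. -/
def hankelH (n : ℤ) (x : ℝ) : ℂ :=
  (if 0 ≤ n then 1 else (-1) ^ n.natAbs) *
    ((besselJ n.natAbs x : ℂ) + Complex.I * (neumannY n.natAbs x : ℂ))

/-- Spherical Hankel function of the first kind
`h_n^{(1)}(x) = √(π / (2 x)) H_{n+1/2}^{(1)}(x)`. -/
def sphHankel (n : ℕ) (x : ℝ) : ℂ :=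
  (Real.sqrt (Real.pi / (2 * x)) : ℂ) *
    ((besselJ (n + 1 / 2) x : ℂ) + Complex.I * (besselY (n + 1 / 2) x : ℂ))

/-- `Z_n(ξ) = ξ H_n^{(1)}'(ξ) / H_n^{(1)}(ξ)`. -/
def cylZ (n : ℤ) (ξ : ℝ) : ℂ := ξ * deriv (hankelH n) ξ / hankelH n ξ

/-- `z_n(ξ) = ξ h_n^{(1)}'(ξ) / h_n^{(1)}(ξ)`. -/
def sphZ (n : ℕ) (ξ : ℝ) : ℂ := ξ * deriv (sphHankel n) ξ / sphHankel n ξ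

/-! ### Spheres, surface measures, harmonics -/

/-- The unit sphere `S_1 ⊂ ℝ^d`. -/
abbrev S1 (d : ℕ) : Type := sphere (0 : EuclideanSpace ℝ (Fin d)) 1

/-- The sphere `S_R ⊂ ℝ^d` of radius `R`. -/
abbrev SR (d : ℕ) (R : ℝ) : Type := sphere (0 : EuclideanSpace ℝ (Fin d)) R

/-- Surface measure of the unit sphere. -/
abbrev σ (d : ℕ) : Measure (S1 d) :=
  (volume : Measure (EuclideanSpace ℝ (Fin d))).toSphere

/-- The dilation `x̂ ↦ R x̂` from `S_1` onto `S_R`. -/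
def dil (d : ℕ) (R : {R : ℝ // 0 < R}) : S1 d ≃ₜ SR d R where
  toFun x := ⟨(R : ℝ) • (x : EuclideanSpace ℝ (Fin d)), by
    have := x.2
    simp only [mem_sphere_iff_norm, sub_zero] at this
    simp [norm_smul, this, abs_of_pos R.2]⟩
  invFun x := ⟨(R : ℝ)⁻¹ • (x : EuclideanSpace ℝ (Fin d)), by
    have := x.2
    simp only [mem_sphere_iff_norm, sub_zero] at this
    simp [norm_smul, this, abs_of_pos R.2, R.2.ne']⟩
  left_inv x := by
    ext1; simp [smul_smul, R.2.ne']
  right_inv x := by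
    ext1; simp [smul_smul, R.2.ne']
  continuous_toFun := by fun_prop
  continuous_invFun := by fun_prop

/-- Surface measure of `S_R`: the image of `R^{d-1} σ` under `x̂ ↦ R x̂`. -/
def surf (d : ℕ) (R : {R : ℝ // 0 < R}) : Measure (SR d R) :=
  ENNReal.ofReal ((R : ℝ) ^ (d - 1)) • (σ d).map (dil d R)

/-- Circular harmonics `Y_n(φ) = e^{inφ} / √(2π)`, as functions on the unit circle. -/
def circHarm (n : ℤ) (x : S1 2) : ℂ :=
  Complex.exp (Complex.I * n * Complex.arg ⟨x.1 0, x.1 1⟩) / (Real.sqrt (2 * Real.pi) : ℂ)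

/-- Associated Legendre function of the first kind on `[-1, 1]`,
`P_n^m(t) = (-1)^m (1-t²)^{m/2} / (2^n n!) (d/dt)^{n+m} (t²-1)^n`. -/
def assocLegendre (n m : ℕ) (t : ℝ) : ℝ :=
  (-1) ^ m * Real.sqrt (1 - t ^ 2) ^ m / (2 ^ n * (n ! : ℝ)) *
    ((Polynomial.derivative^[n + m]) ((Polynomial.X ^ 2 - 1 : Polynomial ℝ) ^ n)).eval t

/-- Spherical harmonics `Y_n^m(φ,θ) = √((2n+1)/(4π) (n-|m|)!/(n+|m|)!) P_n^{|m|}(cos θ) e^{imφ}`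
on the unit sphere, at `x = (cos φ sin θ, sin φ sin θ, cos θ)`. -/
def sphHarm (n : ℕ) (m : ℤ) (x : S1 3) : ℂ :=
  (Real.sqrt ((2 * n + 1) / (4 * Real.pi) *
      (((n - m.natAbs)! : ℝ) / ((n + m.natAbs)! : ℝ))) : ℂ) *
    (assocLegendre n m.natAbs (x.1 2) : ℂ) *
    Complex.exp (Complex.I * m * Complex.arg ⟨x.1 0, x.1 1⟩)

/-- The data of the expansion in a given dimension: harmonics `Y i` on the unit sphere of
`ℝ^dim`, their degrees (`|n|` for `Y_n`, `n` for `Y_n^m`) and the coefficient functions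
(`Z_n` or `z_n`). It is used only for the two systems `circular` and `spherical` below. -/
structure Harmonics where
  dim : ℕ
  Idx : Type
  deg : Idx → ℕ
  Y : Idx → S1 dim → ℂ
  Z : Idx → ℝ → ℂ
  finite_deg : ∀ N : ℕ, {i | deg i ≤ N}.Finite
  memLp_Y : ∀ i, MemLp (Y i) 2 (σ dim)

/-- `d = 2`: indices `n ∈ ℤ`, harmonics `Y_n`, coefficients `Z_n`. -/
def circular : Harmonics where
  dim := 2
  Idx := ℤ
  deg n := n.natAbs
  Y := circHarm
  Z := cylZ
  finite_deg N := (Set.finite_Icc (-(N : ℤ)) N).subset fun n hn => by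
    simp only [Set.mem_ofPred_eq] at hn
    simp only [Set.mem_Icc]; omega
  memLp_Y n := by
    refine MemLp.of_bound (C := 1 / Real.sqrt (2 * Real.pi)) ?_ ?_
    · unfold circHarm
      refine Measurable.aestronglyMeasurable ?_
      have : Measurable fun x : S1 2 => Complex.arg ⟨x.1 0, x.1 1⟩ := by
        refine Complex.measurable_arg.comp ?_
        have h : Continuous fun x : S1 2 => Complex.equivRealProdCLM.symm (x.1 0, x.1 1) := by
          fun_prop
        exact h.measurable
      fun_prop
    · refine Eventually.of_forall fun x => ?_
      unfold circHarm
      rw [norm_div, Complex.norm_exp]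
      simp [abs_of_nonneg (Real.sqrt_nonneg _)]

/-- `d = 3`: indices `(n, m)` with `|m| ≤ n`, harmonics `Y_n^m`, coefficients `z_n`. -/
def spherical : Harmonics where
  dim := 3
  Idx := {p : ℕ × ℤ // |p.2| ≤ (p.1 : ℤ)}
  deg i := i.1.1
  Y i := sphHarm i.1.1 i.1.2
  Z i := sphZ i.1.1
  finite_deg N := by
    have h : ((Set.Iic N) ×ˢ (Set.Icc (-(N : ℤ)) N) : Set (ℕ × ℤ)).Finite :=
      (Set.finite_Iic N).prod (Set.finite_Icc _ _)
    refine (h.preimage (f := Subtype.val)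
      (Subtype.val_injective.injOn)).subset fun i hi => ?_
    have h1 := i.2
    simp only [Set.mem_ofPred_eq] at hi
    have h2 := abs_le.1 h1
    simp only [Set.mem_preimage, Set.mem_prod, Set.mem_Iic, Set.mem_Icc]
    omega
  memLp_Y i := by
    have hc : Continuous fun x : S1 3 => assocLegendre i.1.1 i.1.2.natAbs (x.1 2) := by
      unfold assocLegendre
      fun_prop
    obtain ⟨C, hC⟩ := (isCompact_range hc).isBounded.exists_norm_le
    refine MemLp.of_bound (C := |Real.sqrt ((2 * i.1.1 + 1) / (4 * Real.pi) *
      (((i.1.1 - i.1.2.natAbs)! : ℝ) / ((i.1.1 + i.1.2.natAbs)! : ℝ)))| * C) ?_ ?_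
    · unfold sphHarm
      refine Measurable.aestronglyMeasurable ?_
      have h1 : Measurable fun x : S1 3 => Complex.arg ⟨x.1 0, x.1 1⟩ := by
        refine Complex.measurable_arg.comp ?_
        have h : Continuous fun x : S1 3 => Complex.equivRealProdCLM.symm (x.1 0, x.1 1) := by
          fun_prop
        exact h.measurable
      have h2 := hc.measurable
      fun_prop
    · refine Eventually.of_forall fun x => ?_
      unfold sphHarm
      rw [norm_mul, norm_mul, Complex.norm_exp, Complex.norm_real, Complex.norm_real,
        Real.norm_eq_abs]
      have := hC _ ⟨x, rfl⟩
      have h0 : (Complex.I * (i.1.2 : ℂ) *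
          ((Complex.arg ⟨x.1 0, x.1 1⟩ : ℝ) : ℂ)).re = 0 := by simp
      rw [h0, Real.exp_zero, mul_one]
      exact mul_le_mul_of_nonneg_left this (abs_nonneg _)

variable (S : Harmonics) (R : {R : ℝ // 0 < R})

/-! ### The Sobolev space `H^{1/2}(S_R)` and its (anti)dual -/

/-- Fourier coefficient `v_i(R) = ∫_{S_1} v(R x̂) conj (Y_i(x̂)) ds(x̂)`. -/
def coeff (v : SR S.dim R → ℂ) (i : S.Idx) : ℂ :=
  ∫ x, v (dil S.dim R x) * starRingEnd ℂ (S.Y i x) ∂(σ S.dim)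

/-- The terms `R^{d-1} (1 + n²)^{1/2} |v_i(R)|²` of the squared `H^{1/2}(S_R)`-norm. -/
def normTerm (v : SR S.dim R → ℂ) (i : S.Idx) : ℝ :=
  (R : ℝ) ^ (S.dim - 1) * ((1 + (S.deg i : ℝ) ^ 2) ^ (1 / 2 : ℝ) * ‖coeff S R v i‖ ^ 2)

/-- Square roots of the norm terms, with the phase of the coefficient. -/
def scaled (v : SR S.dim R → ℂ) (i : S.Idx) : ℂ :=
  (Real.sqrt ((R : ℝ) ^ (S.dim - 1) * (1 + (S.deg i : ℝ) ^ 2) ^ (1 / 2 : ℝ)) : ℂ)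
    * coeff S R v i

lemma norm_scaled_sq (v : SR S.dim R → ℂ) (i : S.Idx) :
    ‖scaled S R v i‖ ^ 2 = normTerm S R v i := by
  have hR := R.2
  unfold scaled normTerm
  rw [norm_mul, mul_pow, Complex.norm_real, Real.norm_eq_abs, sq_abs, Real.sq_sqrt (by positivity)]
  ring

lemma surf_ac {p : SR S.dim R → Prop} (h : ∀ᵐ x ∂(surf S.dim R), p x) :
    ∀ᵐ x ∂(σ S.dim), p (dil S.dim R x) := by
  have hR := R.2
  rw [surf, Measure.ae_ennreal_smul_measure_iff (by simpa using pow_pos hR _)] at h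
  exact ae_of_ae_map (dil S.dim R).measurable.aemeasurable h

lemma memLp_comp_dil {v : SR S.dim R → ℂ} (hv : MemLp v 2 (surf S.dim R)) :
    MemLp (fun x => v (dil S.dim R x)) 2 (σ S.dim) := by
  have hR := R.2
  have h0 : ENNReal.ofReal ((R : ℝ) ^ (S.dim - 1)) ≠ 0 := by simpa using pow_pos hR _
  have h1 : MemLp v 2 ((σ S.dim).map (dil S.dim R)) := by
    refine hv.of_measure_le_smul (c := (ENNReal.ofReal ((R : ℝ) ^ (S.dim - 1)))⁻¹)
      (by simpa using h0) ?_
    rw [surf, smul_smul, ENNReal.inv_mul_cancel h0 ENNReal.ofReal_ne_top, one_smul]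
  exact h1.comp_of_map (dil S.dim R).measurable.aemeasurable

lemma coeff_congr {u v : SR S.dim R → ℂ} (h : u =ᵐ[surf S.dim R] v) (i : S.Idx) :
    coeff S R u i = coeff S R v i := by
  refine integral_congr_ae ?_
  filter_upwards [surf_ac S R h] with x hx
  simp only [hx]

lemma coeff_add {u v : SR S.dim R → ℂ} (hu : MemLp u 2 (surf S.dim R))
    (hv : MemLp v 2 (surf S.dim R)) (i : S.Idx) :
    coeff S R (u + v) i = coeff S R u i + coeff S R v i := by
  unfold coeff
  rw [← integral_add]
  · exact integral_congr_ae (Eventually.of_forall fun x => by simp [add_mul])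
  · exact (memLp_comp_dil S R hu).integrable_mul (S.memLp_Y i).star
  · exact (memLp_comp_dil S R hv).integrable_mul (S.memLp_Y i).star

lemma coeff_smul (c : ℂ) (v : SR S.dim R → ℂ) (i : S.Idx) :
    coeff S R (c • v) i = c * coeff S R v i := by
  unfold coeff
  rw [← integral_const_mul]
  exact integral_congr_ae (Eventually.of_forall fun x => by simp [mul_assoc])

/-- The complex space `L²(S_R)`. -/
abbrev L2 : Type := Lp ℂ 2 (surf S.dim R)

lemma scaled_add (u v : L2 S R) :
    scaled S R (⇑(u + v)) = scaled S R u + scaled S R v := by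
  ext i
  simp only [scaled, Pi.add_apply]
  rw [coeff_congr S R (Lp.coeFn_add u v), coeff_add S R (Lp.memLp u) (Lp.memLp v), mul_add]

lemma scaled_smul (c : ℂ) (v : L2 S R) :
    scaled S R (⇑(c • v)) = c • scaled S R v := by
  ext i
  simp only [scaled, Pi.smul_apply, smul_eq_mul]
  rw [coeff_congr S R (Lp.coeFn_smul c v), coeff_smul]
  ring

lemma memℓp_scaled_iff (v : SR S.dim R → ℂ) :
    Memℓp (scaled S R v) 2 ↔ Summable (normTerm S R v) := by
  rw [memℓp_gen_iff (by norm_num)]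
  refine summable_congr fun i => ?_
  rw [← norm_scaled_sq]
  norm_num

/-- Those `v ∈ L²(S_R)` for which the `H^{1/2}(S_R)`-norm is finite. -/
def hHalf : Submodule ℂ (L2 S R) where
  carrier := {v | Summable (normTerm S R v)}
  zero_mem' := by
    have h : scaled S R (⇑(0 : L2 S R)) = 0 := by
      simpa using scaled_smul S R 0 0
    show Summable _
    rw [← memℓp_scaled_iff, h]
    exact zero_memℓp
  add_mem' {u v} hu hv := by
    have hu' : Summable (normTerm S R u) := hu
    have hv' : Summable (normTerm S R v) := hv
    show Summable _
    rw [← memℓp_scaled_iff] at hu' hv' ⊢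
    rw [scaled_add]
    exact hu'.add hv'
  smul_mem' c v hv := by
    have hv' : Summable (normTerm S R v) := hv
    show Summable _
    rw [← memℓp_scaled_iff] at hv' ⊢
    rw [scaled_smul]
    exact hv'.const_smul c

/-- The Sobolev space `H^{1/2}(S_R)` (as a type of its own, since it does not carry the
`L²`-norm). -/
def HHalf : Type := hHalf S R

instance : AddCommGroup (HHalf S R) := inferInstanceAs (AddCommGroup (hHalf S R))
instance : Module ℂ (HHalf S R) := inferInstanceAs (Module ℂ (hHalf S R))

variable {S R}

/-- The element of `L²(S_R)` underlying an element of `H^{1/2}(S_R)`. -/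
def HHalf.toL2 (v : HHalf S R) : L2 S R := Subtype.val (p := fun u => u ∈ hHalf S R) v

/-- An element of `H^{1/2}(S_R)` as a function on `S_R`. -/
instance : CoeFun (HHalf S R) (fun _ => SR S.dim R → ℂ) := ⟨fun v => ⇑v.toL2⟩

/-- `‖v‖_{1/2,2,S_R} = (R^{d-1} ∑ (1 + n²)^{1/2} |v_i(R)|²)^{1/2}`. -/
instance : Norm (HHalf S R) := ⟨fun v => Real.sqrt (∑' i, normTerm S R v i)⟩

lemma HHalf.norm_def (v : HHalf S R) : ‖v‖ = Real.sqrt (∑' i, normTerm S R v i) := rfl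

lemma HHalf.summable (v : HHalf S R) : Summable (normTerm S R v) :=
  Subtype.prop (p := fun u => u ∈ hHalf S R) v

/-- The weighted coefficients as an element of `ℓ²`. -/
def HHalf.toLp (v : HHalf S R) : lp (fun _ : S.Idx => ℂ) 2 :=
  ⟨scaled S R v, (memℓp_scaled_iff S R _).2 v.summable⟩

lemma HHalf.norm_eq_toLp (v : HHalf S R) : ‖v‖ = ‖v.toLp‖ := by
  rw [HHalf.norm_def, lp.norm_eq_tsum_rpow (by norm_num), Real.sqrt_eq_rpow]
  norm_num
  congr 1
  exact tsum_congr fun i => (norm_scaled_sq S R v i).symm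

lemma HHalf.toLp_add (u v : HHalf S R) : (u + v).toLp = u.toLp + v.toLp :=
  Subtype.ext (scaled_add S R u.toL2 v.toL2)

lemma HHalf.toLp_smul (c : ℂ) (v : HHalf S R) : (c • v).toLp = c • v.toLp :=
  Subtype.ext (scaled_smul S R c v.toL2)

instance : SeminormedAddCommGroup (HHalf S R) :=
  SeminormedAddCommGroup.ofCore (𝕜 := ℂ)
    { norm_nonneg := fun v => Real.sqrt_nonneg _
      norm_smul := fun c v => by
        rw [HHalf.norm_eq_toLp, HHalf.toLp_smul, norm_smul, HHalf.norm_eq_toLp]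
      norm_triangle := fun u v => by
        rw [HHalf.norm_eq_toLp, HHalf.toLp_add, HHalf.norm_eq_toLp u, HHalf.norm_eq_toLp v]
        exact norm_add_le _ _ }

instance : NormedSpace ℂ (HHalf S R) where
  norm_smul_le c v := by
    rw [HHalf.norm_eq_toLp, HHalf.toLp_smul, norm_smul, HHalf.norm_eq_toLp]

variable (S R)

/-- `H^{-1/2}(S_R)`: bounded antilinear functionals on `H^{1/2}(S_R)`. A function `g` on `S_R`
is identified with `v ↦ (g, v)_{S_R} = ∫_{S_R} g conj(v) ds`, and for `ℓ ∈ H^{-1/2}(S_R)` the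
pairing `(ℓ, v)_{S_R}` is `ℓ v`. -/
abbrev HMinusHalf : Type := HHalf S R →SL[starRingEnd ℂ] ℂ

/-- The sesquilinear form `(g, v)_{S_R} = ∫_{S_R} g conj(v) ds`. -/
def pairing (g v : SR S.dim R → ℂ) : ℂ := ∫ x, g x * starRingEnd ℂ (v x) ∂(surf S.dim R)

/-- The harmonic `x ↦ Y_i(R⁻¹ x)` on `S_R`. -/
def harm (i : S.Idx) (x : SR S.dim R) : ℂ := S.Y i ((dil S.dim R).symm x)

lemma pairing_harm (i : S.Idx) (v : SR S.dim R → ℂ) :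
    pairing S R (harm S R i) v
      = (((R : ℝ) ^ (S.dim - 1) : ℝ) : ℂ) * starRingEnd ℂ (coeff S R v i) := by
  have hR := R.2
  unfold pairing surf coeff
  rw [integral_smul_measure, (dil S.dim R).measurableEmbedding.integral_map, ← integral_conj,
    ENNReal.toReal_ofReal (by positivity), Complex.real_smul]
  congr 1
  refine integral_congr_ae (Eventually.of_forall fun x => ?_)
  simp [harm, mul_comm]

lemma norm_coeff_le (v : HHalf S R) (i : S.Idx) :
    ‖(((R : ℝ) ^ (S.dim - 1) : ℝ) : ℂ) * starRingEnd ℂ (coeff S R v i)‖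
      ≤ Real.sqrt ((R : ℝ) ^ (S.dim - 1)) * ‖v‖ := by
  have hR := R.2
  have hp : (0 : ℝ) < (R : ℝ) ^ (S.dim - 1) := by positivity
  have h1 : normTerm S R v i ≤ ∑' j, normTerm S R v j :=
    v.summable.le_tsum i fun j _ => by rw [← norm_scaled_sq]; positivity
  have h2 : (1 : ℝ) ≤ (1 + (S.deg i : ℝ) ^ 2) ^ (1 / 2 : ℝ) :=
    Real.one_le_rpow (by nlinarith [sq_nonneg (S.deg i : ℝ)]) (by norm_num)
  rw [HHalf.norm_def, ← Real.sqrt_mul hp.le]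
  refine Real.le_sqrt_of_sq_le ?_
  rw [norm_mul, Complex.norm_real, Real.norm_eq_abs, abs_of_pos hp, RCLike.norm_conj, mul_pow]
  calc ((R : ℝ) ^ (S.dim - 1)) ^ 2 * ‖coeff S R v i‖ ^ 2
      = (R : ℝ) ^ (S.dim - 1) * ((R : ℝ) ^ (S.dim - 1) * (1 * ‖coeff S R v i‖ ^ 2)) := by ring
    _ ≤ (R : ℝ) ^ (S.dim - 1) * normTerm S R v i := by
        unfold normTerm
        gcongr
    _ ≤ _ := by gcongr

lemma coeff_toL2_add (u v : HHalf S R) (i : S.Idx) :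
    coeff S R (u + v).toL2 i = coeff S R u i + coeff S R v i := by
  rw [← coeff_add S R (Lp.memLp u.toL2) (Lp.memLp v.toL2)]
  exact coeff_congr S R (Lp.coeFn_add u.toL2 v.toL2) i

lemma coeff_toL2_smul (c : ℂ) (v : HHalf S R) (i : S.Idx) :
    coeff S R (c • v).toL2 i = c * coeff S R v i := by
  rw [← coeff_smul]
  exact coeff_congr S R (Lp.coeFn_smul c v.toL2) i

/-- The harmonic `Y_i(R⁻¹ ·)` as an element of `H^{-1/2}(S_R)`. -/
def harmDual (i : S.Idx) : HMinusHalf S R :=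
  LinearMap.mkContinuous
    { toFun := fun v => pairing S R (harm S R i) v
      map_add' := fun u v => by
        simp only [pairing_harm, coeff_toL2_add, map_add, mul_add]
      map_smul' := fun c v => by
        simp only [pairing_harm, coeff_toL2_smul, map_mul, smul_eq_mul]
        ring }
    (Real.sqrt ((R : ℝ) ^ (S.dim - 1))) fun v => by
      simpa only [LinearMap.coe_mk, AddHom.coe_mk, pairing_harm] using norm_coeff_le S R v i

lemma harmDual_apply (i : S.Idx) (v : HHalf S R) :
    harmDual S R i v = ∫ x, harm S R i x * starRingEnd ℂ (v x) ∂(surf S.dim R) := rfl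

/-! ### The Dirichlet-to-Neumann operator and its truncation -/

variable {S R}

/-- The terms `R⁻¹ Z_i(κ R) w_i(R) Y_i(R⁻¹ ·)` of the series of `T_κ w`. -/
def dtnTerm (κ : ℝ) (w : HHalf S R) (i : S.Idx) : HMinusHalf S R :=
  (((R : ℝ) : ℂ)⁻¹ * S.Z i (κ * R) * coeff S R w i) • harmDual S R i

/-- The Dirichlet-to-Neumann operator,
`T_κ w = R⁻¹ ∑_i Z_i(κ R) w_i(R) Y_i(R⁻¹ ·)`, a series in `H^{-1/2}(S_R)`. -/
def dtn (κ : ℝ) (w : HHalf S R) : HMinusHalf S R := ∑' i, dtnTerm κ w i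

/-- The truncated operator `T_{κ,N}`: only the harmonics of degree at most `N` are kept. -/
def dtnTrunc (κ : ℝ) (N : ℕ) (w : HHalf S R) : HMinusHalf S R :=
  ∑ i ∈ (S.finite_deg N).toFinset, dtnTerm κ w i

/-- `T_{κ,N} w` as a function on `S_R`. -/
def dtnTruncFun (κ : ℝ) (N : ℕ) (w : HHalf S R) (x : SR S.dim R) : ℂ :=
  ((R : ℝ) : ℂ)⁻¹ * ∑ i ∈ (S.finite_deg N).toFinset,
    S.Z i (κ * R) * coeff S R w i * harm S R i x

lemma integrable_harm_mul (i : S.Idx) (v : HHalf S R) :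
    Integrable (fun x => harm S R i x * starRingEnd ℂ (v x)) (surf S.dim R) := by
  refine Integrable.smul_measure ?_ ENNReal.ofReal_ne_top
  rw [(dil S.dim R).measurableEmbedding.integrable_map_iff]
  refine ((S.memLp_Y i).integrable_mul (memLp_comp_dil S R (Lp.memLp v.toL2)).star).congr
    (Eventually.of_forall fun x => ?_)
  simp [harm]

/-- The functional `T_{κ,N} w` is given by the function `T_{κ,N} w`. -/
lemma dtnTrunc_apply (κ : ℝ) (N : ℕ) (w v : HHalf S R) :
    dtnTrunc κ N w v = pairing S R (dtnTruncFun κ N w) v := by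
  unfold dtnTrunc pairing dtnTruncFun dtnTerm
  simp only [sum_apply, smul_apply, harmDual_apply,
    smul_eq_mul, Finset.mul_sum, Finset.sum_mul]
  rw [integral_finsetSum]
  · refine Finset.sum_congr rfl fun i _ => ?_
    rw [← integral_const_mul]
    refine integral_congr_ae (Eventually.of_forall fun x => ?_)
    simp only
    ring
  · intro i _
    refine ((integrable_harm_mul i v).const_mul
      (((R : ℝ) : ℂ)⁻¹ * S.Z i (κ * R) * coeff S R w i)).congr
      (Eventually.of_forall fun x => ?_)
    simp only
    ring

end DtN

end

namespace DtN

/-! Everything rests on one estimate: at a fixed argument `ξ = κR` the multipliers grow at most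
linearly in the degree, `|Z_i(ξ)| ≤ C (1 + n²)^{1/2}`. The right-hand side is exactly the weight of
the `H^{1/2}` norm. Cauchy–Schwarz therefore bounds the dual norm of any finite partial sum by the
`H^{1/2}` mass of `w` on the same indices (`norm_sum_dtnTerm_le`), and the Cauchy criterion gives
unconditional convergence. The degree cut-offs exhaust the index set, so `T_{κ,N} w → T_κ w` in the
dual norm. Hence `c = ‖(T_κ - T_{κ,N}) w‖ / ‖w‖`, which does not depend on `v`, is a valid choice
(`exists_truncation_bound`).

For the linear bound, `J` and `Y` are real at real arguments, so `|H| ≥ |Y|`, and only large orders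
matter (`exists_linear_bound`). There `Y` is governed by its part singular at the origin, and the
Euler operator `x d/dx` multiplies a power `x^μ` by `μ`, here of size `O(n)`. In integer order the
singular part is a finite sum of positive terms (`neumannPolar_deriv`,
`eventually_pow_le_neumannPolar`, `cylZ_linear_bound`). In half-integer order `Y` is `±J_{-ν}`,
which is comparable to its leading term (`abs_besselJ_neg_ge`, `sphZ_linear_bound`). -/

/-! ### Dual-norm estimates and truncation under a linear multiplier bound -/

/-- Pairing with a harmonic contributes `R^{d-1}` and the multiplier contributes `(1 + n²)^{1/2}`;
their product is shared out as one square root for `w` and one for `v`. -/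
lemma norm_dtnTerm_apply_le {S : Harmonics} {R : {R : ℝ // 0 < R}} {κ C : ℝ}
    (hC : ∀ i, ‖S.Z i (κ * R)‖ ≤ C * (1 + (S.deg i : ℝ) ^ 2) ^ (1 / 2 : ℝ))
    (w v : HHalf S R) (i : S.Idx) :
    ‖dtnTerm κ w i v‖ ≤ (R : ℝ)⁻¹ * C * (‖scaled S R w i‖ * ‖scaled S R v i‖) := by
  have hR := R.2
  have h : dtnTerm κ w i v = ((R : ℝ) : ℂ)⁻¹ * S.Z i (κ * R) * coeff S R w i *
      ((((R : ℝ) ^ (S.dim - 1) : ℝ) : ℂ) * starRingEnd ℂ (coeff S R v i)) := by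
    rw [← pairing_harm]; rfl
  have hp : (0 : ℝ) < (R : ℝ) ^ (S.dim - 1) := by positivity
  rw [h]
  simp only [scaled, norm_mul, norm_inv, Complex.norm_real, Real.norm_eq_abs, abs_of_pos hR,
    abs_of_pos hp, RCLike.norm_conj, abs_of_nonneg (Real.sqrt_nonneg _)]
  have hs := Real.mul_self_sqrt
    (show 0 ≤ (R : ℝ) ^ (S.dim - 1) * (1 + (S.deg i : ℝ) ^ 2) ^ (1 / 2 : ℝ) by positivity)
  calc _ = (R : ℝ)⁻¹ * (R : ℝ) ^ (S.dim - 1) * ‖coeff S R w i‖ * ‖coeff S R v i‖ *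
        ‖S.Z i (κ * R)‖ := by ring
    _ ≤ (R : ℝ)⁻¹ * (R : ℝ) ^ (S.dim - 1) * ‖coeff S R w i‖ * ‖coeff S R v i‖ *
        (C * (1 + (S.deg i : ℝ) ^ 2) ^ (1 / 2 : ℝ)) := by gcongr; exact hC i
    _ = (R : ℝ)⁻¹ * C * ‖coeff S R w i‖ * ‖coeff S R v i‖ *
        ((R : ℝ) ^ (S.dim - 1) * (1 + (S.deg i : ℝ) ^ 2) ^ (1 / 2 : ℝ)) := by ring
    _ = _ := by conv_lhs => rw [← hs]
                ring

/-- Cauchy–Schwarz, enlarging only the `v`-sum to the full norm. Keeping the `w`-sum on an arbitrary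
finite `F` is what yields unconditional convergence. -/
lemma norm_sum_dtnTerm_le {S : Harmonics} {R : {R : ℝ // 0 < R}} {κ C : ℝ} (hC0 : 0 ≤ C)
    (hC : ∀ i, ‖S.Z i (κ * R)‖ ≤ C * (1 + (S.deg i : ℝ) ^ 2) ^ (1 / 2 : ℝ))
    (w : HHalf S R) (F : Finset S.Idx) :
    ‖∑ i ∈ F, dtnTerm κ w i‖ ≤ (R : ℝ)⁻¹ * C * Real.sqrt (∑ i ∈ F, normTerm S R w i) := by
  have hR := R.2
  refine ContinuousLinearMap.opNorm_le_bound _ (by positivity) fun v => ?_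
  rw [sum_apply]
  calc _ ≤ ∑ i ∈ F, ‖dtnTerm κ w i v‖ := norm_sum_le _ _
    _ ≤ ∑ i ∈ F, (R : ℝ)⁻¹ * C * (‖scaled S R w i‖ * ‖scaled S R v i‖) :=
        Finset.sum_le_sum fun i _ => norm_dtnTerm_apply_le hC w v i
    _ = (R : ℝ)⁻¹ * C * ∑ i ∈ F, ‖scaled S R w i‖ * ‖scaled S R v i‖ := by
        rw [Finset.mul_sum]
    _ ≤ (R : ℝ)⁻¹ * C * (Real.sqrt (∑ i ∈ F, ‖scaled S R w i‖ ^ 2) *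
          Real.sqrt (∑ i ∈ F, ‖scaled S R v i‖ ^ 2)) := by
        gcongr
        exact Real.sum_mul_le_sqrt_mul_sqrt _ _ _
    _ ≤ (R : ℝ)⁻¹ * C * (Real.sqrt (∑ i ∈ F, normTerm S R w i) * ‖v‖) := by
        rw [HHalf.norm_def]
        simp only [norm_scaled_sq]
        gcongr
        exact v.summable.sum_le_tsum _ fun i _ => by rw [← norm_scaled_sq]; positivity
    _ = _ := by ring

/-- Unconditional convergence of the Dirichlet-to-Neumann series under a linear bound on the
multipliers. -/
lemma summable_dtnTerm {S : Harmonics} {R : {R : ℝ // 0 < R}} {κ C : ℝ} (hC0 : 0 ≤ C)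
    (hC : ∀ i, ‖S.Z i (κ * R)‖ ≤ C * (1 + (S.deg i : ℝ) ^ 2) ^ (1 / 2 : ℝ))
    (w : HHalf S R) : Summable (dtnTerm κ w) := by
  have hR := R.2
  rw [summable_iff_vanishing_norm]
  intro ε hε
  -- The `+ 1` keeps the divisor positive when `C = 0`.
  have hK : 0 < (R : ℝ)⁻¹ * C + 1 := by positivity
  obtain ⟨s, hs⟩ := summable_iff_vanishing_norm.1 w.summable
    ((ε / ((R : ℝ)⁻¹ * C + 1)) ^ 2) (by positivity)
  refine ⟨s, fun t ht => ?_⟩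
  have h1 : Real.sqrt (∑ i ∈ t, normTerm S R w i) < ε / ((R : ℝ)⁻¹ * C + 1) := by
    rw [Real.sqrt_lt' (by positivity)]
    exact lt_of_abs_lt (hs t ht)
  calc _ ≤ (R : ℝ)⁻¹ * C * Real.sqrt (∑ i ∈ t, normTerm S R w i) :=
        norm_sum_dtnTerm_le hC0 hC w t
    _ ≤ ((R : ℝ)⁻¹ * C + 1) * Real.sqrt (∑ i ∈ t, normTerm S R w i) := by
        gcongr; linarith
    _ < ((R : ℝ)⁻¹ * C + 1) * (ε / ((R : ℝ)⁻¹ * C + 1)) := by gcongr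
    _ = ε := by field_simp

/-- The `H^{1/2}` norm is only available as a seminorm, but each coefficient is controlled by it.
This covers the case `‖w‖ = 0` of the quotient defining `c`. -/
lemma dtnTerm_eq_zero_of_norm_eq_zero {S : Harmonics} {R : {R : ℝ // 0 < R}} (κ : ℝ)
    {w : HHalf S R} (hw : ‖w‖ = 0) : dtnTerm κ w = 0 := by
  have hR := R.2
  have hp : (0 : ℝ) < (R : ℝ) ^ (S.dim - 1) := by positivity
  funext i
  have h := norm_coeff_le S R w i
  rw [hw, mul_zero, norm_le_zero_iff, mul_eq_zero] at h
  have h0 : coeff S R w i = 0 := by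
    rcases h with h | h
    · exact absurd h (by exact_mod_cast hp.ne')
    · simpa using h
  simp only [dtnTerm, h0, mul_zero, Pi.zero_apply]
  exact zero_smul ℂ (harmDual S R i)

lemma tendsto_dtnTrunc {S : Harmonics} {R : {R : ℝ // 0 < R}} {κ : ℝ} {w : HHalf S R}
    (hw : Summable (dtnTerm κ w)) :
    Tendsto (fun N => dtnTrunc κ N w) atTop (𝓝 (dtn κ w)) := by
  refine hw.hasSum.comp (tendsto_atTop_finset_of_monotone (fun M N hMN i => ?_) fun i => ?_)
  · simp only [Set.Finite.mem_toFinset, Set.mem_ofPred_eq]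
    exact fun h => h.trans hMN
  · exact ⟨S.deg i, by simp⟩

lemma exists_truncation_bound {S : Harmonics} {R : {R : ℝ // 0 < R}} {κ : ℝ}
    (hs : ∀ w : HHalf S R, Summable (dtnTerm κ w)) :
    ∃ c : ℕ → HHalf S R → HHalf S R → ℝ,
      (∀ N w v, 0 ≤ c N w v) ∧
      (∀ w v, Tendsto (fun N => c N w v) atTop (𝓝 0)) ∧
      ∀ N w v, ‖(dtn κ w - dtnTrunc κ N w) v‖ ≤ c N w v * ‖w‖ * ‖v‖ := by
  -- For `‖w‖ = 0` the quotient is `0` by the division convention, and then both sides of the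
  -- estimate vanish.
  refine ⟨fun N w _ => ‖dtn κ w - dtnTrunc κ N w‖ / ‖w‖, fun N w v => by positivity,
    fun w v => ?_, fun N w v => ?_⟩
  · have h := ((tendsto_dtnTrunc (hs w)).const_sub (dtn κ w)).norm.div_const ‖w‖
    simpa using h
  · rcases eq_or_ne ‖w‖ 0 with hw | hw
    · have h0 := dtnTerm_eq_zero_of_norm_eq_zero κ hw
      simp [dtn, dtnTrunc, h0, hw]
    · rw [div_mul_cancel₀ _ hw]
      exact ContinuousLinearMap.le_opNorm _ v

/-! ### Power series with coefficients bounded by `M 2^k / k!`, and the Bessel series -/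

lemma summable_mul_exp_terms (M z : ℝ) : Summable fun k : ℕ => M * (2 ^ k / k !) * z ^ k := by
  refine ((Real.summable_pow_div_factorial (2 * z)).mul_left M).congr fun k => ?_
  rw [mul_pow]; ring

lemma tsum_mul_exp_terms (M z : ℝ) :
    ∑' k : ℕ, M * (2 ^ k / k !) * z ^ k = M * Real.exp (2 * z) := by
  rw [Real.exp_eq_exp_ℝ, NormedSpace.exp_eq_tsum_div, ← tsum_mul_left]
  refine tsum_congr fun k => ?_
  rw [mul_pow]; ring

lemma summable_powerSeries {a : ℕ → ℝ} {M : ℝ} (ha : ∀ k, |a k| ≤ M * (2 ^ k / k !)) (z : ℝ) :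
    Summable fun k => a k * z ^ k := by
  refine Summable.of_norm_bounded (summable_mul_exp_terms M |z|) fun k => ?_
  rw [norm_mul, norm_pow, Real.norm_eq_abs, Real.norm_eq_abs]
  gcongr
  exact ha k

lemma abs_powerSeries_le {a : ℕ → ℝ} {M : ℝ} (ha : ∀ k, |a k| ≤ M * (2 ^ k / k !)) {z : ℝ}
    (hz : 0 ≤ z) : |∑' k, a k * z ^ k| ≤ M * Real.exp (2 * z) := by
  rw [← tsum_mul_exp_terms]
  refine tsum_of_norm_bounded (f := fun k => a k * z ^ k)
    (summable_mul_exp_terms M z).hasSum fun k => ?_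
  rw [norm_mul, norm_pow, Real.norm_eq_abs, Real.norm_eq_abs, abs_of_nonneg hz]
  gcongr
  exact ha k

/-- The class of majorants `M 2^k / k!` is stable under termwise differentiation, with `M` replaced
by `2M`. This gives a summable bound on the derivatives, uniform on a ball around `0` containing
`z`. -/
lemma hasDerivAt_powerSeries {a : ℕ → ℝ} {M : ℝ} (ha : ∀ k, |a k| ≤ M * (2 ^ k / k !)) (z : ℝ) :
    HasDerivAt (fun y => ∑' k, a k * y ^ k) (∑' k, a (k + 1) * (k + 1) * z ^ k) z := by
  have hM : 0 ≤ M := by simpa using (abs_nonneg _).trans (ha 0)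
  have hbd : ∀ k : ℕ, |a (k + 1) * (k + 1)| ≤ 2 * M * (2 ^ k / k !) := fun k => by
    rw [abs_mul, abs_of_nonneg (by positivity : (0 : ℝ) ≤ k + 1)]
    calc _ ≤ M * (2 ^ (k + 1) / (k + 1)!) * (k + 1) := by gcongr; exact ha _
      _ = _ := by
        rw [Nat.factorial_succ]; push_cast; field_simp; ring
  set r := |z| + 1
  have hsum : Summable fun k : ℕ => |a k| * k * r ^ (k - 1) := by
    rw [← summable_nat_add_iff 1]
    refine Summable.of_nonneg_of_le (fun k => by positivity) (fun k => ?_)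
      (summable_mul_exp_terms (2 * M) r)
    have := hbd k
    rw [abs_mul, abs_of_nonneg (by positivity : (0 : ℝ) ≤ k + 1)] at this
    simp only [Nat.add_sub_cancel]
    push_cast
    gcongr
  have h := hasDerivAt_tsum_of_isPreconnected (t := ball (0 : ℝ) r) (y₀ := z) (y := z)
    (g := fun k y => a k * y ^ k) (g' := fun k y => a k * (k * y ^ (k - 1))) hsum
    isOpen_ball (convex_ball _ _).isPreconnected
    (fun k y _ => (hasDerivAt_pow k y).const_mul _)
    (fun k y hy => by
      rw [mem_ball_zero_iff, Real.norm_eq_abs] at hy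
      rw [norm_mul, norm_mul, norm_pow, Real.norm_eq_abs, Real.norm_eq_abs, Real.norm_eq_abs,
        Nat.abs_cast, mul_assoc]
      gcongr)
    (by simp [r]) (summable_powerSeries ha z) (by simp [r])
  refine h.congr_deriv ?_
  rw [Summable.tsum_eq_zero_add]
  · simp only [Nat.cast_zero, zero_mul, mul_zero, zero_add, Nat.add_sub_cancel]
    exact tsum_congr fun k => by push_cast; ring
  · rw [← summable_nat_add_iff 1]
    refine (summable_powerSeries hbd z).congr fun k => ?_
    simp only [Nat.add_sub_cancel]; push_cast; ring

/-- A function `(y/2)^ν ∑ a_k (y/2)^{2k}` with coefficients of exponential type: it is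
differentiable at `x > 0`, and it and `x f'(x)` are bounded. -/
lemma frobenius_bounds {a : ℕ → ℝ} {M : ℝ} (ha : ∀ k, |a k| ≤ M * (2 ^ k / k !)) (ν : ℝ)
    {x : ℝ} (hx : 0 < x) {f : ℝ → ℝ}
    (hf : ∀ y, 0 < y → f y = (y / 2) ^ ν * ∑' k, a k * ((y / 2) ^ 2) ^ k) :
    |f x| ≤ M * Real.exp (2 * (x / 2) ^ 2) * (x / 2) ^ ν ∧
    ∃ f', HasDerivAt f f' x ∧
      |x * f'| ≤ (|ν| + 4 * (x / 2) ^ 2) * (M * Real.exp (2 * (x / 2) ^ 2) * (x / 2) ^ ν) := by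
  have hM : 0 ≤ M := by simpa using (abs_nonneg _).trans (ha 0)
  have hbd : ∀ k : ℕ, |a (k + 1) * (k + 1)| ≤ 2 * M * (2 ^ k / k !) := fun k => by
    rw [abs_mul, abs_of_nonneg (by positivity : (0 : ℝ) ≤ k + 1)]
    calc _ ≤ M * (2 ^ (k + 1) / (k + 1)!) * (k + 1) := by gcongr; exact ha _
      _ = _ := by
        rw [Nat.factorial_succ]; push_cast; field_simp; ring
  set z := (x / 2) ^ 2 with hz
  have hz0 : 0 ≤ z := by positivity
  have hp : 0 < (x / 2) ^ ν := by positivity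
  have hg := abs_powerSeries_le ha hz0
  have hg' := abs_powerSeries_le hbd hz0
  set G := ∑' k, a k * z ^ k with hG
  set G' := ∑' k, a (k + 1) * (k + 1) * z ^ k with hG'
  refine ⟨?_, ν * (x / 2) ^ (ν - 1) * (1 / 2) * G + (x / 2) ^ ν * (G' * (x / 2)), ?_, ?_⟩
  · rw [hf x hx, abs_mul, abs_of_pos hp, mul_comm]
    gcongr
  · have h1 : HasDerivAt (fun y : ℝ => y / 2) (1 / 2) x := (hasDerivAt_id x).div_const 2
    have h2 := h1.rpow_const (p := ν) (Or.inl (by positivity))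
    have h3 : HasDerivAt (fun y : ℝ => (y / 2) ^ 2) (x / 2) x := by
      refine (h1.pow 2).congr_deriv ?_
      simp; ring
    have h4 := (hasDerivAt_powerSeries ha z).comp x h3
    have h5 := h2.mul h4
    refine (h5.congr_of_eventuallyEq ?_).congr_deriv ?_
    · filter_upwards [eventually_gt_nhds hx] with y hy
      rw [hf y hy]; rfl
    · simp only [Function.comp, ← hG, ← hG', ← hz]
      ring
  · have h6 : (x / 2) ^ (ν - 1) * (x / 2) = (x / 2) ^ ν := by
      rw [← Real.rpow_add_one (by positivity)]; ring_nf
    have h7 : x * (ν * (x / 2) ^ (ν - 1) * (1 / 2) * G + (x / 2) ^ ν * (G' * (x / 2)))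
        = (x / 2) ^ ν * (ν * G + 2 * z * G') := by
      rw [hz, ← h6]; ring
    rw [h7, abs_mul, abs_of_pos hp]
    calc _ ≤ (x / 2) ^ ν * (|ν| * |G| + 2 * z * |G'|) := by
          gcongr
          refine (abs_add_le _ _).trans_eq ?_
          rw [abs_mul, abs_mul, abs_of_nonneg (by positivity : 0 ≤ 2 * z)]
      _ ≤ (x / 2) ^ ν * (|ν| * (M * Real.exp (2 * z)) + 2 * z * (2 * M * Real.exp (2 * z))) := by
          gcongr
      _ = _ := by ring

lemma rpow_two_mul_add {y : ℝ} (hy : 0 < y) (ν : ℝ) (k : ℕ) :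
    (y / 2) ^ (2 * (k : ℝ) + ν) = (y / 2) ^ ν * ((y / 2) ^ 2) ^ k := by
  rw [Real.rpow_add (by positivity), mul_comm, ← pow_mul, ← Real.rpow_natCast _ (2 * k)]
  push_cast; rfl

lemma besselJ_eq_mul_tsum (ν : ℝ) {y : ℝ} (hy : 0 < y) :
    besselJ ν y = (y / 2) ^ ν *
      ∑' k : ℕ, (-1) ^ k / ((k ! : ℝ) * Real.Gamma (ν + k + 1)) * ((y / 2) ^ 2) ^ k := by
  rw [besselJ, ← tsum_mul_left]
  refine tsum_congr fun k => ?_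
  rw [rpow_two_mul_add hy]; ring

/-- Coefficient bound for `J_ν`, `ν ≥ 0`. -/
lemma besselJ_coeff_le {ν : ℝ} (hν : 0 ≤ ν) (k : ℕ) :
    |(-1) ^ k / ((k ! : ℝ) * Real.Gamma (ν + k + 1))| ≤
      (Real.Gamma (ν + 1))⁻¹ * (2 ^ k / k !) := by
  have hG : Real.Gamma (ν + 1) ≤ Real.Gamma (ν + k + 1) := by
    induction k with
    | zero => simp
    | succ k ih =>
      refine ih.trans ?_
      push_cast
      rw [show ν + (k + 1) + 1 = (ν + k + 1) + 1 by ring, Real.Gamma_add_one (s := ν + k + 1) (by positivity)]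
      exact le_mul_of_one_le_left (Real.Gamma_nonneg_of_nonneg (by positivity))
        (by linarith [(Nat.cast_nonneg k : (0 : ℝ) ≤ k)])
  have h0 : 0 < Real.Gamma (ν + 1) := Real.Gamma_pos_of_pos (by positivity)
  have h1 := h0.trans_le hG
  rw [abs_div, abs_pow, abs_neg, abs_one, one_pow, abs_of_pos (by positivity), one_div, mul_inv,
    div_eq_mul_inv, mul_comm]
  have : (1 : ℝ) ≤ 2 ^ k := one_le_pow₀ (by norm_num)
  calc _ ≤ (Real.Gamma (ν + 1))⁻¹ * (k ! : ℝ)⁻¹ := by gcongr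
    _ ≤ (Real.Gamma (ν + 1))⁻¹ * (2 ^ k * (k ! : ℝ)⁻¹) := by
      gcongr
      exact le_mul_of_one_le_left (by positivity) this

/-! ### From bounds on `J` and `Y` to linear growth of the multipliers -/

/-- Since `Y` is the imaginary part, `|J + iY| ≥ |Y|`; no lower bound on `J` is needed. -/
lemma norm_logDeriv_add_I_mul_le {J Y : ℝ → ℝ} {x J' Y' B b : ℝ}
    (hJ : HasDerivAt J J' x) (hY : HasDerivAt Y Y' x) (hB : |x * J'| + |x * Y'| ≤ B) (hb : 0 < b)
    (hYb : b ≤ |Y x|) :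
    (J x : ℂ) + Complex.I * (Y x : ℂ) ≠ 0 ∧
    HasDerivAt (fun y => (J y : ℂ) + Complex.I * (Y y : ℂ)) ((J' : ℂ) + Complex.I * (Y' : ℂ)) x ∧
    ‖(x : ℂ) * ((J' : ℂ) + Complex.I * (Y' : ℂ)) / ((J x : ℂ) + Complex.I * (Y x : ℂ))‖
      ≤ B / b := by
  have h1 : b ≤ ‖(J x : ℂ) + Complex.I * (Y x : ℂ)‖ := by
    refine hYb.trans ?_
    have := Complex.abs_im_le_norm ((J x : ℂ) + Complex.I * (Y x : ℂ))
    simpa using this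
  refine ⟨norm_pos_iff.1 (hb.trans_le h1), hJ.ofReal_comp.add (hY.ofReal_comp.const_mul _), ?_⟩
  rw [norm_div]
  have h2 : ‖(x : ℂ) * ((J' : ℂ) + Complex.I * (Y' : ℂ))‖ ≤ B := by
    rw [show (x : ℂ) * ((J' : ℂ) + Complex.I * (Y' : ℂ))
      = ((x * J' : ℝ) : ℂ) + Complex.I * ((x * Y' : ℝ) : ℂ) by push_cast; ring]
    refine (norm_add_le _ _).trans ?_
    rw [norm_mul, Complex.norm_I, one_mul, Complex.norm_real, Complex.norm_real]
    exact hB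
  have hB0 : 0 ≤ B := (norm_nonneg _).trans h2
  gcongr

/-- The finitely many exceptional orders are absorbed into the constant, and `n + 1 ≤ 2 (1 +
n²)^{1/2}`. -/
lemma exists_linear_bound {Z : ℕ → ℂ} {C : ℝ} (h : ∀ᶠ n in atTop, ‖Z n‖ ≤ C * (n + 1)) :
    ∃ K : ℝ, 0 ≤ K ∧ ∀ n, ‖Z n‖ ≤ K * (1 + (n : ℝ) ^ 2) ^ (1 / 2 : ℝ) := by
  have hO : Z =O[atTop] fun n : ℕ => (n : ℝ) + 1 := by
    refine Asymptotics.IsBigO.of_bound C (h.mono fun n hn => ?_)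
    rwa [Real.norm_eq_abs, abs_of_nonneg (by positivity)]
  obtain ⟨K, hK, hK'⟩ := Asymptotics.bound_of_isBigO_nat_atTop hO
  refine ⟨K * 2, by positivity, fun n => ?_⟩
  have h1 := hK' (x := n) (by positivity)
  rw [Real.norm_eq_abs, abs_of_nonneg (by positivity)] at h1
  refine h1.trans ?_
  rw [mul_assoc, ← Real.sqrt_eq_rpow]
  gcongr
  have : (n : ℝ) ≤ Real.sqrt (1 + (n : ℝ) ^ 2) := Real.le_sqrt_of_sq_le (by linarith)
  have : (1 : ℝ) ≤ Real.sqrt (1 + (n : ℝ) ^ 2) :=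
    Real.le_sqrt_of_sq_le (by nlinarith [sq_nonneg (n : ℝ)])
  linarith

/-! ### Integer order -/

/-- This crude bound suffices because the factor `(n + k)!` in the series of `Y_n` absorbs linear
growth. -/
lemma abs_digammaSucc_le (m : ℕ) : |digammaSucc m| ≤ m + 1 := by
  have h1 : (0 : ℝ) ≤ (harmonic m : ℝ) := by
    exact_mod_cast Finset.sum_nonneg fun i _ => by positivity
  have h2 : ((harmonic m : ℚ) : ℝ) ≤ m := by
    have : harmonic m ≤ (m : ℚ) := by
      calc harmonic m ≤ ∑ i ∈ Finset.range m, (1 : ℚ) :=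
            Finset.sum_le_sum fun i _ => inv_le_one_of_one_le₀ (by simp)
        _ = m := by simp
    exact_mod_cast this
  have h3 := Real.one_half_lt_eulerMascheroniConstant
  have h4 := Real.eulerMascheroniConstant_lt_two_thirds
  rw [digammaSucc, abs_le]
  constructor <;> linarith [(Nat.cast_nonneg m : (0:ℝ) ≤ m)]

/-- Coefficient bound for the power series part of `Y_n`. -/
lemma neumannY_coeff_le (n k : ℕ) :
    |(-1) ^ k * (digammaSucc k + digammaSucc (n + k)) / ((k ! : ℝ) * ((n + k)! : ℝ))| ≤
      4 * (2 ^ k / k !) := by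
  have h1 : |digammaSucc k + digammaSucc (n + k)| ≤ 2 * (n + k + 1) := by
    have := abs_digammaSucc_le (n + k)
    push_cast at this
    linarith [abs_add_le (digammaSucc k) (digammaSucc (n + k)), abs_digammaSucc_le k,
      (Nat.cast_nonneg n : (0:ℝ) ≤ n)]
  have h2 : ((n : ℝ) + k + 1) ≤ 2 * (n + k)! := by
    have : (n + k) ≤ (n + k)! := Nat.self_le_factorial _
    have h' : 1 ≤ (n + k)! := Nat.factorial_pos _
    exact_mod_cast (by omega : n + k + 1 ≤ 2 * (n + k)!)
  have h3 : (1 : ℝ) ≤ 2 ^ k := one_le_pow₀ (by norm_num)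
  rw [abs_div, abs_mul, abs_pow, abs_neg, abs_one, one_pow, one_mul,
    abs_of_pos (by positivity : (0 : ℝ) < (k ! : ℝ) * ((n + k)! : ℝ)), div_le_iff₀ (by positivity)]
  calc _ ≤ 4 * ((n + k)! : ℝ) := by linarith only [h1, h2]
    _ ≤ 4 * 2 ^ k * ((n + k)! : ℝ) := by
      gcongr
      linarith
    _ = _ := by field_simp

/-- The singular part of `-π Y_n`. -/
noncomputable def neumannPolar (n : ℕ) (x : ℝ) : ℝ :=
  ∑ k ∈ Finset.range n, ((n - 1 - k)! : ℝ) / (k ! : ℝ) * (x / 2) ^ (2 * (k : ℤ) - (n : ℤ))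

lemma neumannPolar_ge {n : ℕ} (hn : 1 ≤ n) {x : ℝ} (hx : 0 < x) :
    ((n - 1)! : ℝ) * ((x / 2) ^ n)⁻¹ ≤ neumannPolar n x := by
  have h := Finset.single_le_sum (s := Finset.range n)
    (f := fun k => ((n - 1 - k)! : ℝ) / (k ! : ℝ) * (x / 2) ^ (2 * (k : ℤ) - (n : ℤ)))
    (fun k _ => by positivity) (Finset.mem_range.2 hn)
  refine le_trans (le_of_eq ?_) h
  simp

/-- The Euler operator multiplies the `k`-th term by `2k - n`, of modulus at most `n` for `k < n`.
All terms are positive, so the absolute values add up to the sum itself. -/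
lemma neumannPolar_deriv (n : ℕ) {x : ℝ} (hx : 0 < x) :
    ∃ P', HasDerivAt (neumannPolar n) P' x ∧ |x * P'| ≤ n * neumannPolar n x := by
  have h1 : HasDerivAt (fun y : ℝ => y / 2) (1 / 2) x := (hasDerivAt_id x).div_const 2
  have hx2 : x / 2 ≠ 0 := by positivity
  have h2 : ∀ k ∈ Finset.range n, HasDerivAt
      (fun y => ((n - 1 - k)! : ℝ) / (k ! : ℝ) * (y / 2) ^ (2 * (k : ℤ) - (n : ℤ)))
      (((n - 1 - k)! : ℝ) / (k ! : ℝ) * (((2 * (k : ℤ) - (n : ℤ) : ℤ) : ℝ) *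
        (x / 2) ^ (2 * (k : ℤ) - (n : ℤ) - 1) * (1 / 2))) x := fun k _ =>
    ((hasDerivAt_zpow _ (x / 2) (Or.inl hx2)).comp x h1).const_mul _
  refine ⟨_, HasDerivAt.fun_sum h2, ?_⟩
  rw [Finset.mul_sum, neumannPolar, Finset.mul_sum]
  refine (Finset.abs_sum_le_sum_abs _ _).trans (Finset.sum_le_sum fun k hk => ?_)
  have hk' := Finset.mem_range.1 hk
  have h3 : x * (((n - 1 - k)! : ℝ) / (k ! : ℝ) * (((2 * (k : ℤ) - (n : ℤ) : ℤ) : ℝ) *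
        (x / 2) ^ (2 * (k : ℤ) - (n : ℤ) - 1) * (1 / 2)))
      = ((2 * (k : ℤ) - (n : ℤ) : ℤ) : ℝ) * (((n - 1 - k)! : ℝ) / (k ! : ℝ) *
        (x / 2) ^ (2 * (k : ℤ) - (n : ℤ))) := by
    rw [zpow_sub_one₀ hx2]; field_simp
  rw [h3, abs_mul, abs_of_nonneg (by positivity : 0 ≤ ((n - 1 - k)! : ℝ) / (k ! : ℝ) *
        (x / 2) ^ (2 * (k : ℤ) - (n : ℤ)))]
  gcongr
  have : |2 * (k : ℤ) - (n : ℤ)| ≤ n := by rw [abs_le]; omega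
  exact_mod_cast this

lemma besselJ_nat_bounds (n : ℕ) {x : ℝ} (hx : 0 < x) :
    |besselJ n x| ≤ Real.exp (2 * (x / 2) ^ 2) * (x / 2) ^ n ∧
    ∃ J', HasDerivAt (besselJ n) J' x ∧
      |x * J'| ≤ (n + 4 * (x / 2) ^ 2) * (Real.exp (2 * (x / 2) ^ 2) * (x / 2) ^ n) := by
  have hc : ∀ k : ℕ, |(-1) ^ k / ((k ! : ℝ) * Real.Gamma ((n : ℝ) + k + 1))| ≤
      1 * (2 ^ k / k !) := fun k => by
    refine (besselJ_coeff_le (Nat.cast_nonneg n) k).trans ?_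
    gcongr
    refine inv_le_one_of_one_le₀ ?_
    rw [Real.Gamma_nat_eq_factorial]
    exact_mod_cast Nat.factorial_pos n
  have h := frobenius_bounds hc n hx fun y hy => besselJ_eq_mul_tsum n hy
  simpa using h

lemma neumannY_series_bounds (n : ℕ) {x : ℝ} (hx : 0 < x) :
    let D : ℝ → ℝ := fun y => ∑' k : ℕ,
        (-1) ^ k * (digammaSucc k + digammaSucc (n + k)) / ((k ! : ℝ) * ((n + k)! : ℝ))
          * (y / 2) ^ (2 * k + n)
    |D x| ≤ 4 * (Real.exp (2 * (x / 2) ^ 2) * (x / 2) ^ n) ∧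
    ∃ D', HasDerivAt D D' x ∧
      |x * D'| ≤ (n + 4 * (x / 2) ^ 2) * (4 * (Real.exp (2 * (x / 2) ^ 2) * (x / 2) ^ n)) := by
  intro D
  have h := frobenius_bounds (neumannY_coeff_le n) n hx (f := D) fun y hy => by
    rw [← tsum_mul_left]
    refine tsum_congr fun k => ?_
    rw [pow_add, pow_mul, Real.rpow_natCast]; ring
  simpa [mul_assoc] using h

/-- `Y_n` is `-1/π` times its singular part, up to terms of the size of `J_n`. -/
lemma neumannY_bounds {x : ℝ} (hx : 0 < x) : ∃ K : ℝ, 0 ≤ K ∧ ∀ n : ℕ,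
    neumannPolar n x / Real.pi - K * (x / 2) ^ n ≤ |neumannY n x| ∧
    ∃ Y', HasDerivAt (neumannY n) Y' x ∧
      |x * Y'| ≤ n * neumannPolar n x + K * (n + 1) * (x / 2) ^ n := by
  set t := (x / 2) ^ 2 with ht
  set E := Real.exp (2 * t) with hE
  set l := |Real.log (x / 2)| with hl
  have ht0 : 0 ≤ t := by positivity
  have hE0 : 0 < E := Real.exp_pos _
  have hl0 : 0 ≤ l := abs_nonneg _
  have hpi := Real.pi_gt_three
  have hc1 : 2 / Real.pi ≤ 1 := by rw [div_le_one Real.pi_pos]; linarith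
  have hc2 : 1 / Real.pi ≤ 1 := by rw [div_le_one Real.pi_pos]; linarith
  have hc1' : 0 ≤ 2 / Real.pi := by positivity
  have hc2' : 0 ≤ 1 / Real.pi := by positivity
  -- In `l + 5`, the logarithmic term gives `l`, differentiating the logarithm gives `1`, and the
  -- digamma series gives `4`. The factor `1 + 4t` comes from `n + 4t ≤ (1 + 4t)(n + 1)`.
  refine ⟨(l + 5) * (1 + 4 * t) * E, by positivity, fun n => ?_⟩
  obtain ⟨hJ, J', hJ', hxJ⟩ := besselJ_nat_bounds n hx
  obtain ⟨hD, D', hD', hxD⟩ := neumannY_series_bounds n hx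
  obtain ⟨P', hP', hxP⟩ := neumannPolar_deriv n hx
  simp only [← ht, ← hE] at hJ hxJ hD hxD
  set D : ℝ → ℝ := fun y => ∑' k : ℕ,
        (-1) ^ k * (digammaSucc k + digammaSucc (n + k)) / ((k ! : ℝ) * ((n + k)! : ℝ))
          * (y / 2) ^ (2 * k + n) with hDdef
  have hY : ∀ y, neumannY n y = 2 / Real.pi * Real.log (y / 2) * besselJ n y
      - 1 / Real.pi * neumannPolar n y - 1 / Real.pi * D y := fun y => rfl
  set p := (x / 2) ^ n with hp
  have hp0 : 0 < p := by positivity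
  have hnt : (n : ℝ) + 4 * t ≤ (1 + 4 * t) * (n + 1) := by
    nlinarith [(Nat.cast_nonneg n : (0:ℝ) ≤ n), mul_nonneg ht0 (Nat.cast_nonneg n : (0:ℝ) ≤ n)]
  constructor
  · have hP0 : 0 ≤ neumannPolar n x := Finset.sum_nonneg fun k _ => by positivity
    have a1 : |2 / Real.pi * Real.log (x / 2) * besselJ n x| ≤ l * (E * p) := by
      rw [abs_mul, abs_mul, abs_of_nonneg hc1']
      calc _ ≤ 1 * l * (E * p) := by gcongr
        _ = _ := by ring
    have a2 : |1 / Real.pi * D x| ≤ 4 * (E * p) := by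
      rw [abs_mul, abs_of_nonneg hc2']
      calc _ ≤ 1 * (4 * (E * p)) := by gcongr
        _ = _ := by ring
    have a3 : (l + 4) * (E * p) ≤ (l + 5) * (1 + 4 * t) * E * p := by
      have : l + 4 ≤ (l + 5) * (1 + 4 * t) := by nlinarith
      nlinarith [mul_pos hE0 hp0]
    have a4 := neg_abs_le (neumannY n x)
    rw [hY] at a4 ⊢
    have a5 : neumannPolar n x / Real.pi = 1 / Real.pi * neumannPolar n x := by ring
    rw [a5]
    linarith [le_abs_self (2 / Real.pi * Real.log (x / 2) * besselJ n x),
      neg_abs_le (1 / Real.pi * D x)]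
  · have h1 : HasDerivAt (fun y : ℝ => y / 2) (1 / 2) x := (hasDerivAt_id x).div_const 2
    have h2 := h1.log (by positivity)
    have h3 := (((h2.const_mul (2 / Real.pi)).mul hJ').sub (hP'.const_mul (1 / Real.pi))).sub
      (hD'.const_mul (1 / Real.pi))
    refine ⟨_, h3, ?_⟩
    have h4 : x * (2 / Real.pi * (1 / 2 / (x / 2)) * besselJ n x
        + 2 / Real.pi * Real.log (x / 2) * J' - 1 / Real.pi * P' - 1 / Real.pi * D')
        = 2 / Real.pi * besselJ n x + 2 / Real.pi * Real.log (x / 2) * (x * J')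
          - 1 / Real.pi * (x * P') - 1 / Real.pi * (x * D') := by
      field_simp
    rw [h4]
    have a1 : |2 / Real.pi * besselJ n x| ≤ E * p := by
      rw [abs_mul, abs_of_nonneg hc1']
      calc _ ≤ 1 * (E * p) := by gcongr
        _ = _ := by ring
    have a2 : |2 / Real.pi * Real.log (x / 2) * (x * J')| ≤ l * ((n + 4 * t) * (E * p)) := by
      rw [abs_mul, abs_mul, abs_of_nonneg hc1']
      calc _ ≤ 1 * l * ((n + 4 * t) * (E * p)) := by gcongr
        _ = _ := by ring
    have a3 : |1 / Real.pi * (x * P')| ≤ n * neumannPolar n x := by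
      rw [abs_mul, abs_of_nonneg hc2']
      calc _ ≤ 1 * |x * P'| := by gcongr
        _ ≤ _ := by linarith
    have a4 : |1 / Real.pi * (x * D')| ≤ (n + 4 * t) * (4 * (E * p)) := by
      rw [abs_mul, abs_of_nonneg hc2']
      calc _ ≤ 1 * |x * D'| := by gcongr
        _ ≤ _ := by linarith
    have a5 : 1 + l * (n + 4 * t) + (n + 4 * t) * 4 ≤ (l + 5) * (1 + 4 * t) * (n + 1) := by
      have : (1 : ℝ) ≤ (1 + 4 * t) * (n + 1) := by
        nlinarith [(Nat.cast_nonneg n : (0:ℝ) ≤ n), mul_nonneg ht0 (Nat.cast_nonneg n : (0:ℝ) ≤ n)]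
      nlinarith [mul_le_mul_of_nonneg_left hnt hl0]
    have a6 := mul_le_mul_of_nonneg_right a5 (mul_pos hE0 hp0).le
    have a7 : ∀ a b c d : ℝ, |a + b - c - d| ≤ |a| + |b| + |c| + |d| := fun a b c d => by
      refine (abs_sub _ _).trans ?_
      gcongr
      refine (abs_sub _ _).trans ?_
      gcongr
      exact abs_add_le _ _
    refine (a7 _ _ _ _).trans ?_
    linarith

/-- The `k = 0` term `(n - 1)! (x/2)^{-n}` alone is enough, because `(x/2)^{2n} / (n - 1)! → 0`. -/
lemma eventually_pow_le_neumannPolar {x : ℝ} (hx : 0 < x) (K : ℝ) :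
    ∀ᶠ n : ℕ in atTop, K * (x / 2) ^ n ≤ neumannPolar n x := by
  have h := (FloorSemiring.tendsto_pow_div_factorial_atTop ((x / 2) ^ 2)).const_mul
    (K * (x / 2) ^ 2)
  rw [mul_zero] at h
  have h' := (h.comp (tendsto_sub_atTop_nat 1)).eventually_le_const zero_lt_one
  filter_upwards [h', eventually_ge_atTop 1] with n hn hn1
  refine le_trans ?_ (neumannPolar_ge hn1 hx)
  obtain ⟨m, rfl⟩ := Nat.exists_eq_add_of_le' hn1
  simp only [Function.comp, Nat.add_sub_cancel] at hn ⊢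
  rw [mul_div_assoc', div_le_one (by positivity)] at hn
  rw [← div_eq_mul_inv, le_div_iff₀ (by positivity)]
  refine le_trans (le_of_eq ?_) hn
  rw [← pow_mul]
  ring

/-- A constant sign cancels in a logarithmic derivative. -/
lemma cylZ_eq (n : ℤ) (ξ : ℝ) : cylZ n ξ = cylZ (n.natAbs : ℤ) ξ := by
  have h : hankelH n = fun y => (if 0 ≤ n then 1 else (-1) ^ n.natAbs : ℂ) *
      hankelH (n.natAbs : ℤ) y := by
    funext y
    rw [hankelH, hankelH, if_pos (Int.natCast_nonneg _), one_mul, Int.natAbs_natCast]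
  have hc : (if 0 ≤ n then 1 else (-1) ^ n.natAbs : ℂ) ≠ 0 := by
    split_ifs <;> simp
  rw [cylZ, h, deriv_const_mul_field, cylZ]
  field_simp

lemma cylZ_linear_bound {ξ : ℝ} (hξ : 0 < ξ) :
    ∃ C : ℝ, 0 ≤ C ∧ ∀ n : ℤ, ‖cylZ n ξ‖ ≤ C * (1 + (n.natAbs : ℝ) ^ 2) ^ (1 / 2 : ℝ) := by
  suffices h : ∃ C : ℝ, 0 ≤ C ∧
      ∀ n : ℕ, ‖cylZ n ξ‖ ≤ C * (1 + (n : ℝ) ^ 2) ^ (1 / 2 : ℝ) by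
    obtain ⟨C, hC, h⟩ := h
    exact ⟨C, hC, fun n => by rw [cylZ_eq]; exact h _⟩
  obtain ⟨K, hK, hY⟩ := neumannY_bounds hξ
  set t := (ξ / 2) ^ 2 with ht
  set E := Real.exp (2 * t) with hE
  have hpi := Real.pi_pos
  -- The constant is the ratio of the derivative bound `3 (n + 1) P` to the lower bound `P / (2π)`,
  -- divided by `n + 1`.
  refine exists_linear_bound (C := 6 * Real.pi) ?_
  -- The first condition makes the regular part of `Y_n` cost at most half of `P / π`; the second
  -- and third absorb into `P` the remainder in `ξ Y_n'` and the whole of `ξ J_n'`.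
  filter_upwards [eventually_pow_le_neumannPolar hξ (2 * Real.pi * K),
    eventually_pow_le_neumannPolar hξ K,
    eventually_pow_le_neumannPolar hξ ((1 + 4 * t) * E),
    eventually_ge_atTop 1] with n h1 h2 h3 hn
  obtain ⟨hYn, Y', hY', hxY⟩ := hY n
  obtain ⟨-, J', hJ', hxJ⟩ := besselJ_nat_bounds n hξ
  simp only [← ht, ← hE] at hxJ
  set P := neumannPolar n ξ
  set p := (ξ / 2) ^ n
  have hp : 0 < p := by positivity
  have hn0 : (0 : ℝ) ≤ n := Nat.cast_nonneg n
  have hP : 0 < P := lt_of_lt_of_le (by positivity) (neumannPolar_ge hn hξ)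
  have hb : P / (2 * Real.pi) ≤ |neumannY n ξ| := by
    refine le_trans ?_ hYn
    have : K * p ≤ P / (2 * Real.pi) := by
      rw [le_div_iff₀ (by positivity)]; linarith
    have h' : P / Real.pi = P / (2 * Real.pi) + P / (2 * Real.pi) := by field_simp; ring
    linarith
  have hB : |ξ * J'| + |ξ * Y'| ≤ 3 * (n + 1) * P := by
    have e1 : (n + 4 * t) * (E * p) ≤ (n + 1) * P := by
      have hnt : (n : ℝ) + 4 * t ≤ (1 + 4 * t) * (n + 1) := by
        nlinarith [mul_nonneg (by positivity : 0 ≤ t) hn0]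
      calc _ ≤ (1 + 4 * t) * (n + 1) * (E * p) := by gcongr
        _ = (n + 1) * ((1 + 4 * t) * E * p) := by ring
        _ ≤ _ := by gcongr
    have e2 : K * (n + 1) * p ≤ (n + 1) * P := by
      calc _ = (n + 1) * (K * p) := by ring
        _ ≤ _ := by gcongr
    linarith
  obtain ⟨-, hd, hr⟩ := norm_logDeriv_add_I_mul_le hJ' hY' hB (by positivity) hb
  have hH : hankelH (n : ℤ) =
      fun y => (besselJ n y : ℂ) + Complex.I * (neumannY n y : ℂ) := by
    funext y
    simp [hankelH]
  rw [cylZ, hH, hd.deriv]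
  refine hr.trans_eq ?_
  field_simp
  ring

/-! ### Half-integer order -/

lemma half_sub_add_natCast_ne_zero (n k : ℕ) : (1 / 2 - n + k : ℝ) ≠ 0 := by
  intro h
  have h' : ((1 - 2 * n + 2 * k : ℤ) : ℝ) = 0 := by push_cast; linarith
  have : (1 - 2 * n + 2 * k : ℤ) = 0 := by exact_mod_cast h'
  omega

lemma Gamma_half_sub_ne_zero (n : ℕ) : Real.Gamma (1 / 2 - n) ≠ 0 := by
  refine Real.Gamma_ne_zero fun m h => half_sub_add_natCast_ne_zero n m ?_
  rw [h]; ring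

/-- A half-odd integer has modulus at least `1/2`, so each use of the functional equation of `Γ`
loses at most a factor `2`. This is the origin of `2^k` in the majorants. -/
lemma abs_Gamma_half_sub_le_two_mul (n k : ℕ) :
    |Real.Gamma (1 / 2 - n + k)| ≤ 2 * |Real.Gamma (1 / 2 - n + (k + 1 : ℕ))| := by
  have h0 := half_sub_add_natCast_ne_zero n k
  push_cast
  rw [← add_assoc, Real.Gamma_add_one h0, abs_mul]
  have h1 : (1 : ℝ) ≤ 2 * |(1 / 2 - n + k : ℝ)| := by
    have h2 : (1 : ℤ) ≤ |1 - 2 * (n : ℤ) + 2 * (k : ℤ)| := Int.one_le_abs (by omega)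
    have h3 : (1 : ℝ) ≤ |1 - 2 * (n : ℝ) + 2 * (k : ℝ)| := by exact_mod_cast h2
    rw [show 1 - 2 * (n : ℝ) + 2 * (k : ℝ) = 2 * (1 / 2 - n + k) by ring, abs_mul] at h3
    simpa using h3
  nlinarith [abs_nonneg (Real.Gamma (1 / 2 - n + k))]

lemma abs_Gamma_half_sub_le (n k : ℕ) :
    |Real.Gamma (1 / 2 - n)| ≤ 2 ^ k * |Real.Gamma (1 / 2 - n + k)| := by
  induction k with
  | zero => simp
  | succ k ih =>
    refine ih.trans ?_
    rw [pow_succ, mul_assoc]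
    gcongr
    exact abs_Gamma_half_sub_le_two_mul n k

/-- The first step of the recursion multiplies by `|1/2 - n| = (2n - 1)/2`, and later steps lose at
most `2` each. The gain `2n - 1` is what makes the constant term of the series of `J_{-ν}` dominate
the rest. -/
lemma mul_abs_Gamma_half_sub_le {n : ℕ} (hn : 1 ≤ n) (k : ℕ) :
    (2 * n - 1) * |Real.Gamma (1 / 2 - n)| ≤
      2 ^ (k + 1) * |Real.Gamma (1 / 2 - n + (k + 1 : ℕ))| := by
  induction k with
  | zero =>
    have h0 := half_sub_add_natCast_ne_zero n 0
    rw [Nat.cast_zero, add_zero] at h0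
    have hn' : (1 : ℝ) ≤ n := by exact_mod_cast hn
    rw [Nat.zero_add, Nat.cast_one, Real.Gamma_add_one h0, abs_mul,
      abs_of_neg (by linarith : (1 / 2 - n : ℝ) < 0)]
    linarith
  | succ k ih =>
    refine ih.trans ?_
    rw [pow_succ _ (k + 1), mul_assoc]
    gcongr
    exact abs_Gamma_half_sub_le_two_mul n (k + 1)

lemma besselJ_neg_coeff_eq (n k : ℕ) :
    |(-1) ^ k / ((k ! : ℝ) * Real.Gamma (-(n + 1 / 2) + k + 1))| =
      (k ! * |Real.Gamma (1 / 2 - n + k)|)⁻¹ := by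
  rw [abs_div, abs_pow, abs_neg, abs_one, one_pow, one_div, abs_mul, Nat.abs_cast]
  congr 4
  ring

lemma besselJ_neg_coeff_le (n k : ℕ) :
    |(-1) ^ k / ((k ! : ℝ) * Real.Gamma (-(n + 1 / 2) + k + 1))| ≤
      |Real.Gamma (1 / 2 - n)|⁻¹ * (2 ^ k / k !) := by
  rw [besselJ_neg_coeff_eq]
  have h0 : 0 < |Real.Gamma (1 / 2 - n)| := abs_pos.2 (Gamma_half_sub_ne_zero n)
  have h := abs_Gamma_half_sub_le n k
  have h1 : 0 < |Real.Gamma (1 / 2 - n + k)| := pos_of_mul_pos_right (h0.trans_le h) (by positivity)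
  rw [inv_mul_eq_div, div_div, inv_eq_one_div, div_le_div_iff₀ (by positivity) (by positivity)]
  nlinarith [mul_le_mul_of_nonneg_left h (by positivity : (0 : ℝ) ≤ k !)]

lemma besselJ_neg_coeff_succ_le {n : ℕ} (hn : 1 ≤ n) (k : ℕ) :
    |(-1) ^ (k + 1) / (((k + 1)! : ℝ) * Real.Gamma (-(n + 1 / 2) + (k + 1 : ℕ) + 1))| ≤
      |Real.Gamma (1 / 2 - n)|⁻¹ / (2 * n - 1) * (2 ^ (k + 1) / (k + 1)!) := by
  rw [besselJ_neg_coeff_eq]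
  have hn' : (1 : ℝ) ≤ n := by exact_mod_cast hn
  have hn2 : (0 : ℝ) < 2 * n - 1 := by linarith
  have h0 : 0 < |Real.Gamma (1 / 2 - n)| := abs_pos.2 (Gamma_half_sub_ne_zero n)
  have h := mul_abs_Gamma_half_sub_le hn k
  have h1 : 0 < |Real.Gamma (1 / 2 - n + (k + 1 : ℕ))| :=
    pos_of_mul_pos_right ((mul_pos hn2 h0).trans_le h) (by positivity)
  rw [← one_div, ← one_div, div_div, div_mul_div_comm,
    div_le_div_iff₀ (by positivity) (by positivity)]
  nlinarith [mul_le_mul_of_nonneg_left h (by positivity : (0 : ℝ) ≤ (k + 1)!)]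

/-- A power series whose constant term dominates the other coefficients. -/
lemma abs_powerSeries_ge {a : ℕ → ℝ} {M : ℝ} (hM : 0 ≤ M)
    (ha : ∀ k, |a (k + 1)| ≤ M * (2 ^ (k + 1) / (k + 1)!)) {z : ℝ} (hz : 0 ≤ z) :
    |a 0| - M * Real.exp (2 * z) ≤ |∑' k, a k * z ^ k| := by
  -- Removing the constant term leaves a series whose coefficients all obey the majorant with this
  -- `M`, including at index `0`.
  set b : ℕ → ℝ := fun k => if k = 0 then 0 else a k
  have hb : ∀ k, |b k| ≤ M * (2 ^ k / k !) := fun k => by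
    cases k with
    | zero => simpa [b] using hM
    | succ k => simpa [b] using ha k
  have h1 : ∑' k, a k * z ^ k = a 0 + ∑' k, b k * z ^ k := by
    have h2 : ∀ k, a k * z ^ k = (if k = 0 then a 0 else 0) + b k * z ^ k := fun k => by
      cases k <;> simp [b]
    rw [tsum_congr h2, Summable.tsum_add _ (summable_powerSeries hb z), tsum_ite_eq]
    exact (hasSum_ite_eq 0 (a 0)).summable
  have h3 := abs_powerSeries_le hb hz
  rw [h1]
  have h4 := abs_sub_abs_le_abs_sub (a 0) (-∑' k, b k * z ^ k)
  rw [abs_neg, sub_neg_eq_add] at h4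
  linarith

/-- The tail of the series is at most `e^{2(x/2)²} / (2n - 1)` relative to the leading term, hence
negligible for large `n`. -/
lemma abs_besselJ_neg_ge {n : ℕ} (hn : 1 ≤ n) {x : ℝ} (hx : 0 < x) :
    |Real.Gamma (1 / 2 - n)|⁻¹ * (x / 2) ^ (-(n + 1 / 2) : ℝ) *
      (1 - Real.exp (2 * (x / 2) ^ 2) / (2 * n - 1)) ≤ |besselJ (-(n + 1 / 2)) x| := by
  have hn' : (1 : ℝ) ≤ n := by exact_mod_cast hn
  have hn2 : (0 : ℝ) < 2 * n - 1 := by linarith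
  have hp : 0 < (x / 2) ^ (-(n + 1 / 2) : ℝ) := by positivity
  have h := abs_powerSeries_ge (by positivity) (besselJ_neg_coeff_succ_le hn)
    (sq_nonneg (x / 2))
    (a := fun k => (-1) ^ k / ((k ! : ℝ) * Real.Gamma (-(n + 1 / 2) + k + 1)))
  rw [besselJ_eq_mul_tsum _ hx, abs_mul, abs_of_pos hp]
  refine le_trans (le_of_eq ?_) (mul_le_mul_of_nonneg_left h hp.le)
  rw [besselJ_neg_coeff_eq]
  simp only [Nat.factorial_zero, Nat.cast_one, one_mul, Nat.cast_zero, add_zero]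
  ring

/-- At half-odd multiples of `π` the cosine vanishes and the sine is `±1`. -/
lemma besselY_half_eq (n : ℕ) : ∃ s : ℝ, |s| = 1 ∧
    besselY (n + 1 / 2) = fun x => s * besselJ (-(n + 1 / 2)) x := by
  have hc : Real.cos ((n + 1 / 2 : ℝ) * Real.pi) = 0 := by
    rw [Real.cos_eq_zero_iff]
    exact ⟨n, by push_cast; ring⟩
  have hs : |Real.sin ((n + 1 / 2 : ℝ) * Real.pi)| = 1 := by
    have h := Real.sin_sq_add_cos_sq ((n + 1 / 2 : ℝ) * Real.pi)
    rw [hc] at h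
    rw [← sq_eq_sq₀ (abs_nonneg _) zero_le_one, sq_abs]
    linarith
  refine ⟨-(Real.sin ((n + 1 / 2 : ℝ) * Real.pi))⁻¹, by rw [abs_neg, abs_inv, hs, inv_one], ?_⟩
  funext x
  rw [besselY, hc]
  ring

lemma Gamma_three_half_mul_factorial_le (n : ℕ) :
    Real.Gamma (3 / 2) * n ! ≤ Real.Gamma (n + 3 / 2) := by
  induction n with
  | zero => simp
  | succ n ih =>
    have h0 : 0 < Real.Gamma (3 / 2) := Real.Gamma_pos_of_pos (by norm_num)
    push_cast
    rw [show (n : ℝ) + 1 + 3 / 2 = (n + 3 / 2) + 1 by ring, Real.Gamma_add_one (by positivity),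
      Nat.factorial_succ]
    push_cast
    calc _ = ((n : ℝ) + 1) * (Real.Gamma (3 / 2) * n !) := by ring
      _ ≤ ((n : ℝ) + 3 / 2) * Real.Gamma (n + 3 / 2) := by
        gcongr
        norm_num

/-- For large orders the leading term of `J_ν` is below that of `J_{-ν}`, `ν = n + 1/2`. -/
lemma eventually_leading_le {x : ℝ} (hx : 0 < x) : ∀ᶠ n : ℕ in atTop,
    (Real.Gamma (n + 1 / 2 + 1))⁻¹ * (x / 2) ^ (n + 1 / 2 : ℝ) ≤
      |Real.Gamma (1 / 2 - n)|⁻¹ * (x / 2) ^ (-(n + 1 / 2) : ℝ) := by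
  have hG : 0 < Real.Gamma (3 / 2) := Real.Gamma_pos_of_pos (by norm_num)
  -- After clearing denominators the claim is `(x/2)^{2n+1} |Γ(1/2 - n)| ≤ Γ(n + 3/2)`. The left
  -- Gamma value is at most `2^n |Γ(1/2)|` and the right one at least `Γ(3/2) n!`, so the factorial
  -- wins.
  have h := (FloorSemiring.tendsto_pow_div_factorial_atTop (2 * (x / 2) ^ 2)).const_mul
    (x / 2 * |Real.Gamma (1 / 2)|)
  rw [mul_zero] at h
  filter_upwards [h.eventually_le_const hG] with n hn
  rw [mul_div_assoc', div_le_iff₀ (by positivity)] at hn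
  have h1 := hn.trans (Gamma_three_half_mul_factorial_le n)
  have h2 := abs_Gamma_half_sub_le n n
  rw [sub_add_cancel] at h2
  have h3 : 0 < |Real.Gamma (1 / 2 - n)| := abs_pos.2 (Gamma_half_sub_ne_zero n)
  have h4 : 0 < Real.Gamma (n + 1 / 2 + 1) := Real.Gamma_pos_of_pos (by positivity)
  have h5 : 0 < (x / 2) ^ (n + 1 / 2 : ℝ) := by positivity
  have h6 : (x / 2) ^ (n + 1 / 2 : ℝ) * (x / 2) ^ (n + 1 / 2 : ℝ)
      = x / 2 * ((x / 2) ^ 2) ^ n := by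
    rw [← Real.rpow_add (by positivity), ← pow_mul, mul_comm, ← pow_succ, ← Real.rpow_natCast]
    congr 1
    push_cast
    ring
  rw [Real.rpow_neg (by positivity), inv_mul_eq_div, ← mul_inv, ← one_div,
    div_le_div_iff₀ h4 (by positivity), one_mul]
  calc _ = x / 2 * ((x / 2) ^ 2) ^ n * |Real.Gamma (1 / 2 - n)| := by rw [← h6]; ring
    _ ≤ x / 2 * ((x / 2) ^ 2) ^ n * (2 ^ n * |Real.Gamma (1 / 2)|) := by gcongr
    _ = x / 2 * |Real.Gamma (1 / 2)| * (2 * (x / 2) ^ 2) ^ n := by rw [mul_pow]; ring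
    _ ≤ _ := by
      refine h1.trans_eq ?_
      congr 1
      ring

/-- The prefactor `√(π / (2x))` is homogeneous of degree `-1/2`, so it adds `-1/2` to the
logarithmic derivative. -/
lemma sphZ_eq {n : ℕ} {ξ : ℝ} (hξ : 0 < ξ) {H' : ℂ}
    (hH0 : (besselJ (n + 1 / 2) ξ : ℂ) + Complex.I * (besselY (n + 1 / 2) ξ : ℂ) ≠ 0)
    (hH : HasDerivAt (fun y => (besselJ (n + 1 / 2) y : ℂ)
      + Complex.I * (besselY (n + 1 / 2) y : ℂ)) H' ξ) :
    sphZ n ξ = -(1 / 2) + ξ * H' /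
      ((besselJ (n + 1 / 2) ξ : ℂ) + Complex.I * (besselY (n + 1 / 2) ξ : ℂ)) := by
  have hpi := Real.pi_pos
  have h1 : HasDerivAt (fun y : ℝ => Real.pi / (2 * y)) (-(Real.pi / (2 * ξ)) / ξ) ξ := by
    have h := ((hasDerivAt_id ξ).const_mul 2).inv (by simpa using hξ.ne')
    refine ((h.const_mul Real.pi).congr_deriv ?_)
    simp
    field_simp
  have hpos : 0 < Real.pi / (2 * ξ) := by positivity
  have h2 := (h1.sqrt hpos.ne').ofReal_comp
  have h3 : HasDerivAt (sphHankel n) _ ξ := h2.mul hH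
  have hs : (Real.sqrt (Real.pi / (2 * ξ)) : ℂ) ≠ 0 := by
    exact_mod_cast (Real.sqrt_pos.2 hpos).ne'
  have hd : -(Real.pi / (2 * ξ)) / ξ / (2 * Real.sqrt (Real.pi / (2 * ξ)))
      = -(Real.sqrt (Real.pi / (2 * ξ)) / (2 * ξ)) := by
    have hs' := (Real.sqrt_pos.2 hpos).ne'
    nth_rewrite 1 [← Real.mul_self_sqrt hpos.le]
    field_simp
  have hξ' : (ξ : ℂ) ≠ 0 := by exact_mod_cast hξ.ne'
  rw [sphZ, h3.deriv, hd, sphHankel]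
  generalize (besselJ (n + 1 / 2) ξ : ℂ) + Complex.I * (besselY (n + 1 / 2) ξ : ℂ) = W at hH0 ⊢
  push_cast
  field_simp

lemma sphZ_linear_bound {ξ : ℝ} (hξ : 0 < ξ) :
    ∃ C : ℝ, 0 ≤ C ∧ ∀ n : ℕ, ‖sphZ n ξ‖ ≤ C * (1 + (n : ℝ) ^ 2) ^ (1 / 2 : ℝ) := by
  set t := (ξ / 2) ^ 2 with ht
  set E := Real.exp (2 * t) with hE
  have ht0 : 0 ≤ t := by positivity
  have hE0 : 0 < E := Real.exp_pos _
  -- The `1` covers the `1/2` from the square-root prefactor; the rest is `2E(1 + 4t)(n + 1)Q`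
  -- divided by `Q/2`, with `Q` the leading term of `J_{-ν}` in modulus.
  refine exists_linear_bound (C := 1 + 4 * E * (1 + 4 * t)) ?_
  filter_upwards [eventually_leading_le hξ, eventually_ge_atTop 1,
    tendsto_natCast_atTop_atTop.eventually_ge_atTop (E + 1)] with n h1 hn hnE
  have hn0 : (0 : ℝ) ≤ n := Nat.cast_nonneg n
  obtain ⟨s, hs, hYs⟩ := besselY_half_eq n
  have hν : (0 : ℝ) ≤ n + 1 / 2 := by positivity
  obtain ⟨-, J', hJ', hxJ⟩ := frobenius_bounds (besselJ_coeff_le hν) (n + 1 / 2) hξ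
    fun y hy => besselJ_eq_mul_tsum _ hy
  obtain ⟨-, L', hL', hxL⟩ := frobenius_bounds (besselJ_neg_coeff_le n) (-(n + 1 / 2)) hξ
    fun y hy => besselJ_eq_mul_tsum _ hy
  have hY' : HasDerivAt (besselY (n + 1 / 2)) (s * L') ξ := by
    rw [hYs]; exact hL'.const_mul s
  have hlow := abs_besselJ_neg_ge hn hξ
  rw [abs_neg] at hxL
  rw [abs_of_nonneg hν] at hxJ hxL
  simp only [← ht, ← hE] at hxJ hxL hlow
  have hG : 0 < |Real.Gamma (1 / 2 - n)| := abs_pos.2 (Gamma_half_sub_ne_zero n)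
  set Q := |Real.Gamma (1 / 2 - n)|⁻¹ * (ξ / 2) ^ (-(n + 1 / 2) : ℝ) with hQ
  have hQ0 : 0 < Q := by positivity
  have hb : Q / 2 ≤ |besselY (n + 1 / 2) ξ| := by
    rw [hYs, abs_mul, hs, one_mul]
    refine le_trans ?_ hlow
    -- The condition `n ≥ E + 1` ensures `2n - 1 ≥ 2E`, so the tail costs at most half of `Q`.
    have : E / (2 * n - 1) ≤ 1 / 2 := by
      rw [div_le_iff₀ (by linarith)]; linarith
    nlinarith
  have hB : |ξ * J'| + |ξ * (s * L')| ≤ 2 * E * (1 + 4 * t) * (n + 1) * Q := by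
    have e0 : |ξ * (s * L')| = |ξ * L'| := by
      rw [abs_mul, abs_mul, abs_mul, hs, one_mul]
    have e1 : (n : ℝ) + 1 / 2 + 4 * t ≤ (1 + 4 * t) * (n + 1) := by
      nlinarith [mul_nonneg ht0 hn0]
    have e2 : |ξ * J'| ≤ E * (1 + 4 * t) * (n + 1) * Q := by
      calc _ ≤ _ := hxJ
        _ = E * (n + 1 / 2 + 4 * t) *
            ((Real.Gamma (n + 1 / 2 + 1))⁻¹ * (ξ / 2) ^ (n + 1 / 2 : ℝ)) := by ring
        _ ≤ E * ((1 + 4 * t) * (n + 1)) * Q := by gcongr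
        _ = _ := by ring
    have e3 : |ξ * L'| ≤ E * (1 + 4 * t) * (n + 1) * Q := by
      calc _ ≤ _ := hxL
        _ = E * (n + 1 / 2 + 4 * t) * Q := by rw [hQ]; ring
        _ ≤ E * ((1 + 4 * t) * (n + 1)) * Q := by gcongr
        _ = _ := by ring
    rw [e0]
    linarith
  obtain ⟨hH0, hd, hr⟩ := norm_logDeriv_add_I_mul_le hJ' hY' hB (by positivity) hb
  rw [sphZ_eq hξ hH0 hd]
  refine (norm_add_le _ _).trans ?_
  have e4 : 2 * E * (1 + 4 * t) * (n + 1) * Q / (Q / 2) = 4 * E * (1 + 4 * t) * (n + 1) := by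
    field_simp; ring
  rw [e4] at hr
  have e5 : ‖(-(1 / 2) : ℂ)‖ = 1 / 2 := by simp
  rw [e5]
  linarith

end DtN

theorem lemmal (S : DtN.Harmonics) (hS : S = DtN.circular ∨ S = DtN.spherical)
    (R : {R : ℝ // 0 < R}) (κ : ℝ) (hκ : 0 < κ) :
    (∀ w : DtN.HHalf S R, Summable (DtN.dtnTerm κ w)) ∧
    ∃ c : ℕ → DtN.HHalf S R → DtN.HHalf S R → ℝ,
      (∀ N w v, 0 ≤ c N w v) ∧
      (∀ w v, Tendsto (fun N => c N w v) atTop (𝓝 0)) ∧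
      ∀ N w v, ‖(DtN.dtn κ w - DtN.dtnTrunc κ N w) v‖ ≤ c N w v * ‖w‖ * ‖v‖ := by
  have hξ : 0 < κ * (R : ℝ) := mul_pos hκ R.2
  have hZ : ∃ C : ℝ, 0 ≤ C ∧
      ∀ i, ‖S.Z i (κ * R)‖ ≤ C * (1 + (S.deg i : ℝ) ^ 2) ^ (1 / 2 : ℝ) := by
    rcases hS with rfl | rfl
    · exact DtN.cylZ_linear_bound hξ
    · obtain ⟨C, hC, h⟩ := DtN.sphZ_linear_bound hξ
      exact ⟨C, hC, fun i => h i.1.1⟩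
  obtain ⟨C, hC0, hC⟩ := hZ
  have hs : ∀ w : DtN.HHalf S R, Summable (DtN.dtnTerm κ w) := DtN.summable_dtnTerm hC0 hC
  exact ⟨hs, DtN.exists_truncation_bound hs⟩
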